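/- Let $q$ be a prime power, let $n>1$ be an integer, let $K=\mathbb F_{q^n}$ and let $m=\frac{q^n-1}{q-1}$. A polynomial $f(t)\in K[t]$ is called $(n,q)$-quasi-symmetric if $f(t)=\mathbf f(t,t^q,\dots,t^{q^{n-1}})$ for some polynomial $\mathbf f\in K[X_1,\dots,X_n]$ that is invariant under the cyclic permutation $(1\,2\,\cdots\,n)$ of the variables. Let $g,h\in\mathbb F_q[t]$ be $(n,q)$-quasi-symmetric polynomials (with coefficients in $\mathbb F_q$) such that $\deg g=\deg h$ and neither $g$ nor $h$ has a zero in $\mathbb F_{q^n}$. Let $F_1\subseteq F_2\subseteq\cdots$ be a tower of fields with $F_1=K(x_1)$ the rational function field over $K$ and, for every $i\ge 1$, $F_{i+1}=F_i(x_{i+1})$, where $$x_{i+1}^{\,m}=\frac{g(x_i)}{h(x_i)} .$$ Assume that, for every $i\ge1$, $\frac{g(x_i)}{h(x_i)}\ne w^{m}$ for all $w\in F_i$. Then all rational places split completely throughout the tower: for all $1\le i\le j$, the extension $F_j/F_i$ is finite, and every rational place $P$ of $F_i$ (that is, every place of $F_i/K$ of degree one) splits completely in $F_j$, i.e. there are exactly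 $[F_j:F_i]$ places of $F_j$ lying over $P$. -/

import Mathlib

open Polynomial

namespace KummerTower

/-- A multivariate polynomial is quasi-symmetric if it is fixed by the cyclic permutation
`(1 2 … n)` of its variables. -/
def IsQuasiSymmetric {R : Type*} [CommRing R] {n : ℕ} (P : MvPolynomial (Fin n) R) : Prop :=
  MvPolynomial.rename (finRotate n) P = P

/-- An `(n,q)`-quasi-symmetric polynomial over `R`: the value `P(t, t^q, …, t^(q^(n-1)))` of a
quasi-symmetric polynomial `P` in `n` variables. -/
def IsNQQuasiSymmetric {R : Type*} [CommRing R] (n q : ℕ) (f : R[X]) : Prop :=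
  ∃ P : MvPolynomial (Fin n) R, IsQuasiSymmetric P ∧
    f = MvPolynomial.aeval (fun i : Fin n => (X : R[X]) ^ q ^ (i : ℕ)) P

/-- A place of a function field `F` with constants `K`, given by its valuation ring: a proper
valuation subring of `F` that contains `K`. -/
structure Place (K F : Type*) [Field K] [Field F] [Algebra K F] where
  ring : ValuationSubring F
  const_mem : ∀ c : K, algebraMap K F c ∈ ring
  ne_top : ring ≠ ⊤

namespace Place

variable {K F : Type*} [Field K] [Field F] [Algebra K F]

/-- The embedding of the constants into the residue class field of a place. -/
noncomputable def constToResidue (P : Place K F) : K →+* IsLocalRing.ResidueField P.ring :=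
  (IsLocalRing.residue P.ring).comp
    ((algebraMap K F).codRestrict P.ring.toSubring P.const_mem)

/-- The degree of a place: the dimension of its residue class field over the constants. -/
noncomputable def degree (P : Place K F) : ℕ :=
  letI : Algebra K (IsLocalRing.ResidueField P.ring) := P.constToResidue.toAlgebra
  Module.finrank K (IsLocalRing.ResidueField P.ring)

/-- A rational place is a place of degree one. -/
def IsRational (P : Place K F) : Prop := P.degree = 1

/-- A place `Q` of an extension `E` of `F` lies over `P` if its valuation ring meets `F` in the
valuation ring of `P`. -/
def LiesOver {E : Type*} [Field E] [Algebra K E] [Algebra F E]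
    (Q : Place K E) (P : Place K F) : Prop :=
  Q.ring.comap (algebraMap F E) = P.ring

/-- `P` splits completely in the finite extension `E` of `F`: there are exactly `[E : F]`
distinct places of `E` over `P`. -/
def SplitsCompletely (P : Place K F) (E : Type*) [Field E] [Algebra K E] [Algebra F E] : Prop :=
  FiniteDimensional F E ∧ {Q : Place K E | Q.LiesOver P}.ncard = Module.finrank F E

end Place

/-- The `i`-th field `K(x₀, …, xᵢ)` of the tower generated by the sequence `x`. -/
def field (K : Type*) {Ω : Type*} [Field K] [Field Ω] [Algebra K Ω] (x : ℕ → Ω) (i : ℕ) :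
    IntermediateField K Ω :=
  IntermediateField.adjoin K (x '' Set.Iic i)

theorem field_mono (K : Type*) {Ω : Type*} [Field K] [Field Ω] [Algebra K Ω] (x : ℕ → Ω) {i j : ℕ}
    (h : i ≤ j) : field K x i ≤ field K x j :=
  IntermediateField.adjoin.mono K _ _ (Set.image_mono (Set.Iic_subset_Iic.mpr h))

end KummerTower

/-! For `a` in `K`, raising to the `q`-th power permutes `a, a^q, …, a^(q^(n-1))` cyclically, so `g`
and `h`, having coefficients in `F_q`, take values on `K` fixed by Frobenius, hence in `F_q`. At a
rational place the residue of `g(x_i)/h(x_i)` is therefore a nonzero `c` in `F_q`: a quotient of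
values, or of leading coefficients if `x_i` has a pole, since the degrees agree. As `α ↦ α^m` is the
norm from `K` onto `F_q`, `c = α^m`; and `K` contains the `m`-th roots of unity because `m ∣ q^n -
1`.

So each step `E = F(y)` is a Kummer extension in which `y` has a nonzero constant residue at every
place over `P`. The Galois group multiplies `y` by distinct constants, so its elements give places
with distinct residues of `y`. Conversely a place over `P` is determined by that residue
(`eq_of_valuation_sub_lt_one`), and a norm argument shows that every residue arises from the group.
Thus there are `[E : F]` places over `P` (`ncard_comap_eq_finrank`). They are again rational, so the
argument iterates up the tower. -/

namespace ValuationSubring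

variable {F E : Type*} [Field F] [Field E]

/-! ### Valuation rings of an extension lying over a given one. -/

theorem valuation_comap_lt_one_iff (V : ValuationSubring E) (f : F →+* E) (x : F) :
    (V.comap f).valuation x < 1 ↔ V.valuation (f x) < 1 := by
  rw [← mem_nonunits_iff, ← mem_nonunits_iff, mem_nonunits_iff_or, mem_nonunits_iff_or, mem_comap,
    map_inv₀, map_eq_zero]

theorem valuation_comap_le_one_iff (V : ValuationSubring E) (f : F →+* E) (x : F) :
    (V.comap f).valuation x ≤ 1 ↔ V.valuation (f x) ≤ 1 := by
  rw [valuation_le_one_iff, valuation_le_one_iff, mem_comap]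

theorem valuation_comap_eq_one_iff (V : ValuationSubring E) (f : F →+* E) (x : F) :
    (V.comap f).valuation x = 1 ↔ V.valuation (f x) = 1 := by
  rw [eq_iff_le_not_lt, eq_iff_le_not_lt, valuation_comap_lt_one_iff, valuation_comap_le_one_iff]

/-- A valuation ring of `E` dominating the image of `O` meets `F` in exactly `O`: if `x` lay in it
but not in `O`, then `x⁻¹ ∈ O` would become a unit, hence be one in `O` already. -/
theorem exists_comap_eq (O : ValuationSubring F) (f : F →+* E) :
    ∃ V : ValuationSubring E, V.comap f = O := by
  obtain ⟨V, h, hloc⟩ := IsLocalRing.exists_factor_valuationRing (f.comp O.subtype)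
  refine ⟨V, (le_antisymm (fun x hx => h ⟨x, hx⟩) fun x hx => ?_).symm⟩
  by_contra hxO
  have hx0 : x ≠ 0 := by rintro rfl; exact hxO O.zero_mem
  have hinv : x⁻¹ ∈ O := (O.mem_or_inv_mem x).resolve_left hxO
  have hunit : IsUnit (⟨x⁻¹, hinv⟩ : O) := by
    apply hloc.map_nonunit
    refine isUnit_iff_exists_inv.mpr ⟨⟨f x, hx⟩, Subtype.ext ?_⟩
    change f x⁻¹ * f x = 1
    rw [← map_mul, inv_mul_cancel₀ hx0, map_one]
  obtain ⟨⟨b, hb⟩, hxb⟩ := isUnit_iff_exists_inv.mp hunit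
  have hxb' : x⁻¹ * b = 1 := congrArg Subtype.val hxb
  exact hxO (((inv_mul_eq_one₀ hx0).mp hxb') ▸ hb)

section Algebra

variable [Algebra F E]

/-- The elements of `E` lying in every valuation subring of `E` over `O`. -/
def commonSubring (O : ValuationSubring F) (E : Type*) [Field E] [Algebra F E] : Subring E :=
  ⨅ W : {W : ValuationSubring E // W.comap (algebraMap F E) = O}, W.1.toSubring

theorem mem_commonSubring {O : ValuationSubring F} {b : E} :
    b ∈ O.commonSubring E ↔
      ∀ W : ValuationSubring E, W.comap (algebraMap F E) = O → b ∈ W := by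
  simp [commonSubring, Subring.mem_iInf]

theorem map_mem_commonSubring {O : ValuationSubring F} {b : E} (hb : b ∈ O.commonSubring E)
    (σ : E ≃ₐ[F] E) : σ b ∈ O.commonSubring E := by
  rw [mem_commonSubring] at hb ⊢
  intro W hW
  refine hb (W.comap (σ : E →+* E)) ?_
  rw [comap_comap, ← hW]
  congr 1
  ext c
  exact σ.commutes c

/-- An algebraic equation of `z` is divided by a coefficient of largest valuation, the one of
highest index among these. -/
theorem exists_relation [Algebra.IsAlgebraic F E] (O : ValuationSubring F) (z : E) :
    ∃ (N j : ℕ) (c : ℕ → F), j < N ∧ (∀ i, c i ∈ O) ∧ c j = 1 ∧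
      (∀ i, j < i → O.valuation (c i) < 1) ∧
      ∑ i ∈ Finset.range N, algebraMap F E (c i) * z ^ i = 0 := by
  obtain ⟨p, hp0, hp⟩ := Algebra.IsAlgebraic.isAlgebraic (R := F) z
  obtain ⟨j₀, hj₀, hmax₀⟩ := p.support.exists_max_image (fun i => O.valuation (p.coeff i))
    (Polynomial.support_nonempty.mpr hp0)
  obtain ⟨j, hj, hmax⟩ := (p.support.filter fun i =>
    O.valuation (p.coeff i) = O.valuation (p.coeff j₀)).exists_max_image id
      ⟨j₀, by simpa using hj₀⟩
  rw [Finset.mem_filter] at hj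
  have hcj : p.coeff j ≠ 0 := Polynomial.mem_support_iff.mp hj.1
  have hvj : O.valuation (p.coeff j) ≠ 0 := (Valuation.ne_zero_iff _).mpr hcj
  have hle : ∀ i, O.valuation (p.coeff i) ≤ O.valuation (p.coeff j) := fun i => by
    by_cases hi : i ∈ p.support
    · exact hj.2 ▸ hmax₀ i hi
    · simp [Polynomial.notMem_support_iff.mp hi]
  refine ⟨p.natDegree + 1, j, fun i => p.coeff i / p.coeff j,
    Nat.lt_succ_of_le (Polynomial.le_natDegree_of_mem_supp j hj.1), fun i => ?_, div_self hcj,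
    fun i hi => ?_, ?_⟩
  · rw [← valuation_le_one_iff, map_div₀]
    exact div_le_one_of_le₀ (hle i) zero_le
  · rw [map_div₀, div_lt_one₀ (zero_lt_iff.mpr hvj)]
    refine lt_of_le_of_ne (hle i) fun heq => ?_
    have hi' : i ∈ p.support := by
      rw [Polynomial.mem_support_iff, ← Valuation.ne_zero_iff O.valuation, heq]
      exact hvj
    exact absurd (hmax i (Finset.mem_filter.mpr ⟨hi', heq.trans hj.2⟩)) (not_le.mpr hi)
  · rw [Polynomial.aeval_eq_sum_range] at hp
    have := congrArg (fun t => t / algebraMap F E (p.coeff j)) hp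
    simp only [Finset.sum_div, zero_div] at this
    rw [← this]
    refine Finset.sum_congr rfl fun i _ => ?_
    rw [map_div₀, Algebra.smul_def]
    ring

/-- Every `V` over `O` is a localization of the common subring. The denominator is the upper part `s
= ∑_{i ≥ j} c_i z^(i-j)` of the relation. It is integral at `W` if `z` is; otherwise the relation
rewrites it as a polynomial in `z⁻¹`. At `V` it is `1` plus terms of valuation less than `1`. -/
theorem exists_denominator [Algebra.IsAlgebraic F E] {O : ValuationSubring F}
    {V : ValuationSubring E} (hV : V.comap (algebraMap F E) = O) {z : E} (hz : z ∈ V) :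
    ∃ s ∈ O.commonSubring E, z * s ∈ O.commonSubring E ∧ V.valuation s = 1 := by
  obtain ⟨N, j, c, hjN, hc, hcj, hlt, hrel⟩ := O.exists_relation z
  have hcW : ∀ W : ValuationSubring E, W.comap (algebraMap F E) = O →
      ∀ i, algebraMap F E (c i) ∈ W := fun W hW i => by
    have := hc i
    rwa [← hW, mem_comap] at this
  rw [← Finset.sum_range_add_sum_Ico _ hjN.le] at hrel
  -- The case `e = 0` is `s`, the case `e = 1` is `z * s`. Since `i < j` and `e ≤ 1`, the exponent
  -- `j - i - e` below is not truncated.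
  have key : ∀ e : ℕ, e ≤ 1 →
      (∑ i ∈ Finset.Ico j N, algebraMap F E (c i) * z ^ (i - j + e)) ∈ O.commonSubring E := by
    intro e he
    rw [mem_commonSubring]
    intro W hW
    by_cases hzW : z ∈ W
    · exact sum_mem fun i _ => W.toSubring.mul_mem (hcW W hW i) (pow_mem hzW _)
    · have hz0 : z ≠ 0 := by rintro rfl; exact hzW W.zero_mem
      have hinv := (W.mem_or_inv_mem z).resolve_left hzW
      have : ∑ i ∈ Finset.Ico j N, algebraMap F E (c i) * z ^ (i - j + e) =
          -∑ i ∈ Finset.range j, algebraMap F E (c i) * z⁻¹ ^ (j - i - e) := by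
        rw [eq_neg_iff_add_eq_zero, add_comm, ← mul_left_inj' (pow_ne_zero j hz0), zero_mul,
          add_mul, Finset.sum_mul, Finset.sum_mul, ← mul_zero (z ^ e), ← hrel, mul_add,
          Finset.mul_sum, Finset.mul_sum]
        congr 1
        · refine Finset.sum_congr rfl fun i hi => ?_
          rw [Finset.mem_range] at hi
          have h1 : z⁻¹ ^ (j - i - e) * z ^ j = z ^ (e + i) := by
            rw [inv_pow, inv_mul_eq_iff_eq_mul₀ (pow_ne_zero _ hz0), ← pow_add]
            congr 1
            omega
          rw [mul_assoc, h1, pow_add]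
          ring
        · refine Finset.sum_congr rfl fun i hi => ?_
          rw [Finset.mem_Ico] at hi
          have h1 : z ^ (i - j + e) * z ^ j = z ^ (e + i) := by
            rw [← pow_add]
            congr 1
            omega
          rw [mul_assoc, h1, pow_add]
          ring
      rw [this]
      exact W.toSubring.neg_mem (sum_mem fun i _ => W.toSubring.mul_mem (hcW W hW i) (pow_mem hinv _))
  refine ⟨_, key 0 zero_le_one, ?_, ?_⟩
  · have := key 1 le_rfl
    convert! this using 1
    rw [Finset.mul_sum]
    refine Finset.sum_congr rfl fun i _ => ?_
    rw [pow_succ, add_zero]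
    ring
  · rw [Finset.sum_eq_sum_Ico_succ_bot hjN, hcj]
    simp only [map_one, add_zero, tsub_self, pow_zero, mul_one]
    refine Valuation.map_one_add_of_lt _ (Valuation.map_sum_lt _ one_ne_zero fun i hi => ?_)
    rw [Finset.mem_Ico] at hi
    rw [map_mul, map_pow]
    have h1 : V.valuation (algebraMap F E (c i)) < 1 := by
      rw [← valuation_comap_lt_one_iff, hV]
      exact hlt i (by omega)
    exact mul_lt_one_of_lt_of_le h1 (pow_le_one₀ zero_le ((valuation_le_one_iff _ _).mpr hz))

variable [FiniteDimensional F E] [IsGalois F E]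

/-- In `Tr(e b) = ∑ σ(e) σ(b)` all `σ(b)` are integral at `V`, and modulo the maximal ideal only `σ
= 1` contributes, giving `b`. So elements of the common subring have residues coming from `F`. -/
theorem valuation_sub_trace_lt_one {O : ValuationSubring F} {V : ValuationSubring E}
    (hV : V.comap (algebraMap F E) = O) {e : E} (he : V.valuation (e - 1) < 1)
    (heσ : ∀ σ : E ≃ₐ[F] E, σ ≠ 1 → V.valuation (σ e) < 1) {b : E}
    (hb : b ∈ O.commonSubring E) :
    V.valuation (b - algebraMap F E (Algebra.trace F E (e * b))) < 1 := by
  classical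
  have hbV : ∀ σ : E ≃ₐ[F] E, V.valuation (σ b) ≤ 1 := fun σ =>
    (valuation_le_one_iff _ _).mpr (mem_commonSubring.mp (map_mem_commonSubring hb σ) V hV)
  have : b - algebraMap F E (Algebra.trace F E (e * b)) =
      -((e - 1) * b + ∑ σ ∈ Finset.univ.erase (1 : E ≃ₐ[F] E), σ e * σ b) := by
    rw [trace_eq_sum_automorphisms, ← Finset.add_sum_erase _ _ (Finset.mem_univ (1 : E ≃ₐ[F] E))]
    simp only [map_mul, AlgEquiv.one_apply]
    ring
  rw [this, Valuation.map_neg]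
  refine Valuation.map_add_lt _ ?_ (Valuation.map_sum_lt _ one_ne_zero fun σ hσ => ?_)
  · rw [map_mul]
    exact mul_lt_one_of_lt_of_le he (hbV 1)
  · rw [map_mul]
    exact mul_lt_one_of_lt_of_le (heσ σ (Finset.ne_of_mem_erase hσ)) (hbV σ)

theorem valuation_eq_one_iff_of_sub_lt_one {V : ValuationSubring E} {a b : E}
    (h : V.valuation (a - b) < 1) : V.valuation a = 1 ↔ V.valuation b = 1 := by
  constructor
  · intro ha
    rw [← ha, Valuation.map_eq_of_sub_lt]
    rwa [ha, Valuation.map_sub_swap]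
  · intro hb
    rw [← hb, Valuation.map_eq_of_sub_lt]
    rwa [hb]

/-- The same trace approximates `s` at both `V` and `W`, and it lies in `F`, where the two valuation
rings agree. So a denominator that is a unit at `V` is a unit at `W`. -/
theorem le_of_idempotent {O : ValuationSubring F} {V W : ValuationSubring E}
    (hV : V.comap (algebraMap F E) = O) (hW : W.comap (algebraMap F E) = O) {e : E}
    (heV : V.valuation (e - 1) < 1) (heσV : ∀ σ : E ≃ₐ[F] E, σ ≠ 1 → V.valuation (σ e) < 1)
    (heW : W.valuation (e - 1) < 1) (heσW : ∀ σ : E ≃ₐ[F] E, σ ≠ 1 → W.valuation (σ e) < 1) :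
    V ≤ W := by
  intro z hz
  obtain ⟨s, hs, hzs, hs1⟩ := exists_denominator hV hz
  have hsW : W.valuation s = 1 := by
    rw [valuation_eq_one_iff_of_sub_lt_one (valuation_sub_trace_lt_one hW heW heσW hs),
      ← valuation_comap_eq_one_iff, hW, ← hV, valuation_comap_eq_one_iff,
      ← valuation_eq_one_iff_of_sub_lt_one (valuation_sub_trace_lt_one hV heV heσV hs)]
    exact hs1
  have := (valuation_le_one_iff _ _).mpr (mem_commonSubring.mp hzs W hW)
  rwa [map_mul, hsW, mul_one, valuation_le_one_iff] at this

/-- Writing `z = (z s) / s` with a denominator `s`, the quotient of the two traces approximates `z`;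
the residue field does not grow. -/
theorem exists_sub_algebraMap_lt_one {O : ValuationSubring F} {V : ValuationSubring E}
    (hV : V.comap (algebraMap F E) = O) {e : E} (he : V.valuation (e - 1) < 1)
    (heσ : ∀ σ : E ≃ₐ[F] E, σ ≠ 1 → V.valuation (σ e) < 1) {z : E} (hz : z ∈ V) :
    ∃ t ∈ O, V.valuation (z - algebraMap F E t) < 1 := by
  obtain ⟨s, hs, hzs, hs1⟩ := exists_denominator hV hz
  have h1 := valuation_sub_trace_lt_one hV he heσ hs
  have h2 := valuation_sub_trace_lt_one hV he heσ hzs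
  set t₁ := Algebra.trace F E (e * s)
  set t₂ := Algebra.trace F E (e * (z * s))
  have ht₁ : V.valuation (algebraMap F E t₁) = 1 :=
    (valuation_eq_one_iff_of_sub_lt_one h1).mp hs1
  have ht₀ : algebraMap F E t₁ ≠ 0 := by
    rw [← Valuation.ne_zero_iff V.valuation, ht₁]
    exact one_ne_zero
  have hlt : V.valuation (z - algebraMap F E (t₂ / t₁)) < 1 := by
    have heq : (z - algebraMap F E (t₂ / t₁)) * algebraMap F E t₁ =
        (z * s - algebraMap F E t₂) - z * (s - algebraMap F E t₁) := by
      rw [map_div₀, sub_mul, div_mul_cancel₀ _ ht₀]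
      ring
    have : V.valuation ((z - algebraMap F E (t₂ / t₁)) * algebraMap F E t₁) < 1 := by
      rw [heq]
      refine Valuation.map_sub_lt _ h2 ?_
      rw [map_mul, mul_comm]
      exact mul_lt_one_of_lt_of_le h1 ((valuation_le_one_iff _ _).mpr hz)
    rwa [map_mul, ht₁, mul_one] at this
  refine ⟨t₂ / t₁, ?_, hlt⟩
  rw [← hV, mem_comap, ← sub_sub_cancel z (algebraMap F E (t₂ / t₁))]
  exact V.toSubring.sub_mem hz ((valuation_le_one_iff _ _).mp hlt.le)

end Algebra

end ValuationSubring

/-! ### Kummer generators with constant residues. -/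

namespace ValuationSubring

variable {K F E : Type*} [Field K] [Field F] [Field E] [Algebra K F] [Algebra F E] [Algebra K E]

theorem valuation_algebraMap_eq_one {V : ValuationSubring E}
    (hK : ∀ c : K, algebraMap K E c ∈ V) {c : K} (hc : c ≠ 0) :
    V.valuation (algebraMap K E c) = 1 := by
  have h1 := (valuation_le_one_iff _ _).mpr (hK c)
  have h2 := (valuation_le_one_iff _ _).mpr (hK c⁻¹)
  refine le_antisymm h1 ?_
  rw [map_inv₀, map_inv₀] at h2
  exact (inv_le_one₀ (zero_lt_iff.mpr ((Valuation.ne_zero_iff _).mpr (by simpa using hc)))).mp h2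

theorem valuation_algebraMap_lt_one_iff {V : ValuationSubring E}
    (hK : ∀ c : K, algebraMap K E c ∈ V) {c : K} :
    V.valuation (algebraMap K E c) < 1 ↔ c = 0 := by
  constructor
  · intro h
    by_contra hc
    exact h.ne (valuation_algebraMap_eq_one hK hc)
  · rintro rfl
    simp

theorem valuation_prod_sub_one_lt_one (V : ValuationSubring E) {ι : Type*} (s : Finset ι)
    (f : ι → E) (hf : ∀ i ∈ s, V.valuation (f i - 1) < 1) :
    V.valuation (∏ i ∈ s, f i - 1) < 1 := by
  classical
  induction s using Finset.induction_on with
  | empty => simp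
  | insert i s hi ih =>
    rw [Finset.prod_insert hi]
    have h1 := hf i (Finset.mem_insert_self _ _)
    have h2 := ih fun j hj => hf j (Finset.mem_insert_of_mem hj)
    have : f i * ∏ j ∈ s, f j - 1 =
        (f i - 1) * (∏ j ∈ s, f j - 1) + ((f i - 1) + (∏ j ∈ s, f j - 1)) := by ring
    rw [this]
    refine Valuation.map_add_lt _ ?_ (Valuation.map_add_lt _ h1 h2)
    rw [map_mul]
    exact mul_lt_one_of_lt_of_le h1 h2.le

theorem valuation_lt_one_of_prod_lt_one (V : ValuationSubring E) {ι : Type*} {s : Finset ι}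
    {f : ι → E} (h : V.valuation (∏ i ∈ s, f i) < 1) : ∃ i ∈ s, V.valuation (f i) < 1 := by
  by_contra! hcon
  rw [map_prod] at h
  exact absurd h (not_lt.mpr (Finset.one_le_prod' hcon))

variable [FiniteDimensional F E] [IsScalarTower K F E]

/-- Lagrange interpolation in `y`: the product is `1` at `y = a` and `0` at `y = ζ τ * a` for `τ ≠
1`, while `σ` moves the residue of `y` from `a` to `ζ σ * a`. The element depends only on `a`, so it
serves all `V` with this residue at once. -/
theorem exists_kummer_idempotent {y : E} {ζ : (E ≃ₐ[F] E) → K}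
    (hζ : ∀ σ : E ≃ₐ[F] E, σ y = algebraMap K E (ζ σ) * y) (hζ1 : ∀ σ, σ ≠ 1 → ζ σ ≠ 1)
    {a : K} (ha : a ≠ 0) :
    ∃ e : E, ∀ V : ValuationSubring E, (∀ c : K, algebraMap K E c ∈ V) →
      V.valuation (y - algebraMap K E a) < 1 →
      V.valuation (e - 1) < 1 ∧ ∀ σ : E ≃ₐ[F] E, σ ≠ 1 → V.valuation (σ e) < 1 := by
  classical
  have hne : ∀ σ, σ ≠ 1 → a - ζ σ * a ≠ 0 := fun σ hσ h => hζ1 σ hσ (by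
    rw [sub_eq_zero] at h
    exact mul_right_cancel₀ ha (by rw [← h, one_mul]))
  refine ⟨∏ τ ∈ Finset.univ.erase (1 : E ≃ₐ[F] E),
    (y - algebraMap K E (ζ τ * a)) / algebraMap K E (a - ζ τ * a), fun V hK hV => ⟨?_, ?_⟩⟩
  · refine V.valuation_prod_sub_one_lt_one _ _ fun τ hτ => ?_
    have h0 := hne τ (Finset.ne_of_mem_erase hτ)
    have h0' : algebraMap K E (a - ζ τ * a) ≠ 0 := (_root_.map_ne_zero _).mpr h0
    have : (y - algebraMap K E (ζ τ * a)) / algebraMap K E (a - ζ τ * a) - 1 =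
        (y - algebraMap K E a) / algebraMap K E (a - ζ τ * a) := by
      rw [div_sub_one h0', map_sub]
      ring
    rw [this, map_div₀, valuation_algebraMap_eq_one hK h0, div_one]
    exact hV
  · intro σ hσ
    have hyV : V.valuation y ≤ 1 := by
      have := Valuation.map_add_le _ hV.le ((valuation_le_one_iff _ _).mpr (hK a))
      rwa [sub_add_cancel] at this
    have hcomm : ∀ c : K, σ (algebraMap K E c) = algebraMap K E c := fun c => by
      rw [IsScalarTower.algebraMap_apply K F E, σ.commutes]
    have hval : ∀ τ ∈ Finset.univ.erase (1 : E ≃ₐ[F] E),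
        V.valuation (σ ((y - algebraMap K E (ζ τ * a)) / algebraMap K E (a - ζ τ * a))) =
          V.valuation (algebraMap K E (ζ σ) * y - algebraMap K E (ζ τ * a)) := fun τ hτ => by
      rw [map_div₀, map_sub, hcomm, hcomm, hζ, map_div₀,
        valuation_algebraMap_eq_one hK (hne τ (Finset.ne_of_mem_erase hτ)), div_one]
    have hσ' : σ ∈ Finset.univ.erase (1 : E ≃ₐ[F] E) :=
      Finset.mem_erase.mpr ⟨hσ, Finset.mem_univ _⟩
    -- The factor with `τ = σ` is `ζ σ * (y - a)`, of valuation less than `1`; the other factors are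
    -- integral.
    rw [map_prod, map_prod, Finset.prod_congr rfl hval, ← Finset.mul_prod_erase _ _ hσ']
    refine mul_lt_one_of_lt_of_le ?_ (Finset.prod_le_one' fun τ _ => ?_)
    · rw [map_mul, ← mul_sub, map_mul, mul_comm]
      exact mul_lt_one_of_lt_of_le hV ((valuation_le_one_iff _ _).mpr (hK _))
    · refine Valuation.map_sub_le _ ?_ ((valuation_le_one_iff _ _).mpr (hK _))
      rw [map_mul]
      exact mul_le_one' ((valuation_le_one_iff _ _).mpr (hK _)) hyV

variable [IsGalois F E]

theorem eq_of_valuation_sub_lt_one {y : E} {ζ : (E ≃ₐ[F] E) → K}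
    (hζ : ∀ σ : E ≃ₐ[F] E, σ y = algebraMap K E (ζ σ) * y) (hζ1 : ∀ σ, σ ≠ 1 → ζ σ ≠ 1)
    {a : K} (ha : a ≠ 0) {O : ValuationSubring F} (hO : ∀ c : K, algebraMap K F c ∈ O)
    {V W : ValuationSubring E}
    (hV : V.comap (algebraMap F E) = O) (hW : W.comap (algebraMap F E) = O)
    (hVa : V.valuation (y - algebraMap K E a) < 1)
    (hWa : W.valuation (y - algebraMap K E a) < 1) : V = W := by
  have hK : ∀ U : ValuationSubring E, U.comap (algebraMap F E) = O →
      ∀ c : K, algebraMap K E c ∈ U := fun U hU c => by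
    have := hO c
    rwa [← hU, mem_comap, ← IsScalarTower.algebraMap_apply] at this
  obtain ⟨e, he⟩ := exists_kummer_idempotent hζ hζ1 ha
  obtain ⟨h1, h2⟩ := he V (hK V hV) hVa
  obtain ⟨h3, h4⟩ := he W (hK W hW) hWa
  exact le_antisymm (le_of_idempotent hV hW h1 h2 h3 h4) (le_of_idempotent hW hV h3 h4 h1 h2)

/-- The valuation subrings over `O` in a Kummer extension `E = F(y)` are a principal homogeneous
space under the Galois group, provided that `y` has a nonzero constant residue at each of them. -/
theorem ncard_comap_eq_finrank {y : E} {ζ : (E ≃ₐ[F] E) → K}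
    (hζ : ∀ σ : E ≃ₐ[F] E, σ y = algebraMap K E (ζ σ) * y) (hζ1 : ∀ σ, σ ≠ 1 → ζ σ ≠ 1)
    {O : ValuationSubring F} (hO : ∀ c : K, algebraMap K F c ∈ O)
    (hres : ∀ V : ValuationSubring E, V.comap (algebraMap F E) = O →
      ∃ a : K, a ≠ 0 ∧ V.valuation (y - algebraMap K E a) < 1) :
    {V : ValuationSubring E | V.comap (algebraMap F E) = O}.ncard = Module.finrank F E := by
  classical
  have hK : ∀ U : ValuationSubring E, U.comap (algebraMap F E) = O →
      ∀ c : K, algebraMap K E c ∈ U := fun U hU c => by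
    have := hO c
    rwa [← hU, mem_comap, ← IsScalarTower.algebraMap_apply] at this
  obtain ⟨V, hV⟩ := O.exists_comap_eq (algebraMap F E)
  obtain ⟨a, ha, hVa⟩ := hres V hV
  have hVσ : ∀ σ : E ≃ₐ[F] E, (V.comap (σ : E →+* E)).comap (algebraMap F E) = O := fun σ => by
    rw [comap_comap, ← hV]
    congr 1
    ext c
    exact σ.commutes c
  have hcomm : ∀ (σ : E ≃ₐ[F] E) (c : K), σ (algebraMap K E c) = algebraMap K E c := fun σ c => by
    rw [IsScalarTower.algebraMap_apply K F E, σ.commutes]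
  have hζ0 : ∀ σ, ζ σ ≠ 0 := fun σ h => by
    have h1 := hζ σ
    rw [h, map_zero, zero_mul, map_eq_zero_iff σ σ.injective] at h1
    rw [h1, zero_sub, Valuation.map_neg, valuation_algebraMap_lt_one_iff (hK V hV)] at hVa
    exact ha hVa
  have hy0 : y ≠ 0 := by
    rintro rfl
    rw [zero_sub, Valuation.map_neg, valuation_algebraMap_lt_one_iff (hK V hV)] at hVa
    exact ha hVa
  have hinj : ∀ σ τ, ζ σ = ζ τ → σ = τ := fun σ τ h => by
    by_contra hne
    refine hζ1 (τ⁻¹ * σ) (fun h' => hne (inv_mul_eq_one.mp h').symm) ?_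
    have h1 : (τ⁻¹ * σ) y = y := by
      rw [AlgEquiv.mul_apply, hζ σ, h, ← hζ τ, ← AlgEquiv.mul_apply, inv_mul_cancel,
        AlgEquiv.one_apply]
    rw [hζ, mul_eq_right₀ hy0] at h1
    exact (algebraMap K E).injective (h1.trans (map_one _).symm)
  have hlt : ∀ (σ : E ≃ₐ[F] E) (b : K),
      (V.comap (σ : E →+* E)).valuation (y - algebraMap K E b) < 1 ↔
        V.valuation (σ y - algebraMap K E b) < 1 := fun σ b => by
    rw [valuation_comap_lt_one_iff]
    simp [hcomm]
  have hσa : ∀ σ : E ≃ₐ[F] E,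
      (V.comap (σ : E →+* E)).valuation (y - algebraMap K E (ζ σ * a)) < 1 := fun σ => by
    rw [hlt, hζ, map_mul, ← mul_sub, map_mul, valuation_algebraMap_eq_one (hK V hV) (hζ0 σ),
      one_mul]
    exact hVa
  rw [← IsGalois.card_aut_eq_finrank, ← Set.ncard_univ]
  symm
  refine Set.ncard_congr (fun σ _ => V.comap (σ : E →+* E)) (fun σ _ => hVσ σ) ?_ ?_
  · intro σ τ _ _ h
    have h1 := hσa σ
    rw [show V.comap (σ : E →+* E) = V.comap (τ : E →+* E) from h] at h1
    have h2 := Valuation.map_sub_lt _ h1 (hσa τ)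
    rw [sub_sub_sub_cancel_left, ← map_sub, valuation_algebraMap_lt_one_iff (hK _ (hVσ τ)),
      sub_eq_zero] at h2
    exact hinj σ τ (mul_right_cancel₀ ha h2).symm
  · intro W hW
    obtain ⟨b, hb, hWb⟩ := hres W hW
    have hWy : ∀ σ : E ≃ₐ[F] E, W.valuation (σ (y - algebraMap K E b)) ≤ 1 := fun σ => by
      have : W.valuation y ≤ 1 := by
        have := Valuation.map_add_le _ hWb.le ((valuation_le_one_iff _ _).mpr (hK W hW b))
        rwa [sub_add_cancel] at this
      rw [map_sub, hcomm, hζ]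
      refine Valuation.map_sub_le _ ?_ ((valuation_le_one_iff _ _).mpr (hK W hW b))
      rw [map_mul]
      exact mul_le_one' ((valuation_le_one_iff _ _).mpr (hK W hW _)) this
    -- Surjectivity: the norm of `y - b` lies in `F`, so it has valuation less than `1` at `V` as
    -- well. Hence some conjugate `σ (y - b)` does, and the pullback of `V` by `σ` has the same
    -- residue `b` as `W`.
    have hN : W.valuation (algebraMap F E (Algebra.norm F (y - algebraMap K E b))) < 1 := by
      rw [Algebra.norm_eq_prod_automorphisms, map_prod,
        ← Finset.mul_prod_erase _ _ (Finset.mem_univ (1 : E ≃ₐ[F] E))]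
      exact mul_lt_one_of_lt_of_le hWb (Finset.prod_le_one' fun σ _ => hWy σ)
    rw [← valuation_comap_lt_one_iff, hW, ← hV, valuation_comap_lt_one_iff,
      Algebra.norm_eq_prod_automorphisms] at hN
    obtain ⟨σ, -, hσ⟩ := V.valuation_lt_one_of_prod_lt_one hN
    rw [map_sub, hcomm, ← hlt] at hσ
    exact ⟨σ, Set.mem_univ _, eq_of_valuation_sub_lt_one hζ hζ1 hb hO (hVσ σ) hW hσ hWb⟩

end ValuationSubring

/-! ### Galois property of Kummer extensions. -/

theorem isGalois_of_pow_eq {F E : Type*} [Field F] [Field E] [Algebra F E] {m : ℕ} (hm : 0 < m)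
    {ζ : F} (hζ : IsPrimitiveRoot ζ m) {y : E} (hy0 : y ≠ 0) {u : F}
    (hy : y ^ m = algebraMap F E u) (hgen : IntermediateField.adjoin F {y} = ⊤) :
    FiniteDimensional F E ∧ IsGalois F E := by
  have : NeZero m := ⟨hm.ne'⟩
  have hu : u ≠ 0 := by
    rintro rfl
    rw [map_zero] at hy
    exact hy0 (pow_eq_zero_iff hm.ne' |>.mp hy)
  have hsplit : IsSplittingField F E (X ^ m - C u) := by
    rw [isSplittingField_iff_intermediateField]
    constructor
    · rw [Polynomial.map_sub, Polynomial.map_pow, map_X, map_C]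
      exact X_pow_sub_C_splits_of_isPrimitiveRoot
        (hζ.map_of_injective (algebraMap F E).injective) hy
    · rw [eq_top_iff, ← hgen]
      refine IntermediateField.adjoin.mono F _ _ (Set.singleton_subset_iff.mpr ?_)
      rw [mem_rootSet]
      exact ⟨X_pow_sub_C_ne_zero hm u, by simp [hy]⟩
  exact ⟨IsSplittingField.finiteDimensional E (X ^ m - C u),
    IsGalois.of_separable_splitting_field (p := X ^ m - C u)
      (separable_X_pow_sub_C u (hζ.neZero').out hu)⟩

/-! ### Rational places and complete splitting. -/

namespace KummerTower.Place

theorem ring_injective {K F : Type*} [Field K] [Field F] [Algebra K F] :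
    Function.Injective (ring : Place K F → ValuationSubring F) := by
  rintro ⟨O, _, _⟩ ⟨_, _, _⟩ rfl
  rfl

theorem isRational_iff {K F : Type*} [Field K] [Field F] [Algebra K F] (P : Place K F) :
    P.IsRational ↔
      ∀ z ∈ P.ring, ∃ a : K, P.ring.valuation (z - algebraMap K F a) < 1 := by
  let : Algebra K (IsLocalRing.ResidueField P.ring) := P.constToResidue.toAlgebra
  have hres : ∀ (z : P.ring) (a : K), a • (1 : IsLocalRing.ResidueField P.ring) =
      IsLocalRing.residue P.ring z ↔ P.ring.valuation ((z : F) - algebraMap K F a) < 1 := by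
    intro z a
    rw [Algebra.smul_def, mul_one, eq_comm, ← sub_eq_zero]
    change IsLocalRing.residue P.ring z -
      IsLocalRing.residue P.ring ⟨algebraMap K F a, P.const_mem a⟩ = 0 ↔ _
    rw [← map_sub, IsLocalRing.residue_eq_zero_iff, ValuationSubring.valuation_lt_one_iff]
    rfl
  change Module.finrank K (IsLocalRing.ResidueField P.ring) = 1 ↔ _
  rw [finrank_eq_one_iff_of_nonzero' 1 one_ne_zero]
  constructor
  · intro h z hz
    obtain ⟨a, ha⟩ := h (IsLocalRing.residue P.ring ⟨z, hz⟩)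
    exact ⟨a, (hres ⟨z, hz⟩ a).mp ha⟩
  · intro h w
    obtain ⟨z, rfl⟩ := IsLocalRing.residue_surjective w
    obtain ⟨a, ha⟩ := h z z.2
    exact ⟨a, (hres z a).mpr ha⟩

variable {K F E : Type*} [Field K] [Field F] [Field E] [Algebra K F] [Algebra F E] [Algebra K E]

theorem ncard_liesOver [IsScalarTower K F E] (P : Place K F) :
    {Q : Place K E | Q.LiesOver P}.ncard =
      {V : ValuationSubring E | V.comap (algebraMap F E) = P.ring}.ncard := by
  rw [← Set.ncard_image_of_injective _ ring_injective]
  congr 1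
  ext V
  constructor
  · rintro ⟨Q, hQ, rfl⟩
    exact hQ
  · intro hV
    rw [Set.mem_ofPred_eq] at hV
    refine ⟨⟨V, fun c => ?_, ?_⟩, hV, rfl⟩
    · have := P.const_mem c
      rwa [← hV, ValuationSubring.mem_comap, ← IsScalarTower.algebraMap_apply] at this
    · rintro rfl
      refine P.ne_top (hV.symm.trans ?_)
      ext z
      simp only [ValuationSubring.mem_comap, ValuationSubring.mem_top]

theorem splitsCompletely_of_pow_eq [IsScalarTower K F E] {m : ℕ} (hm : 0 < m) {ζ : K} (hζ : IsPrimitiveRoot ζ m)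
    {y : E} {u : F} (hy : y ^ m = algebraMap F E u)
    (hgen : IntermediateField.adjoin F {y} = ⊤) (P : Place K F) (hP : P.IsRational)
    {α : K} (hα : α ≠ 0) (hu : P.ring.valuation (u - algebraMap K F (α ^ m)) < 1) :
    P.SplitsCompletely E ∧ ∀ Q : Place K E, Q.LiesOver P → Q.IsRational := by
  classical
  have hK : ∀ V : ValuationSubring E, V.comap (algebraMap F E) = P.ring →
      ∀ c : K, algebraMap K E c ∈ V := fun V hV c => by
    have := P.const_mem c
    rwa [← hV, ValuationSubring.mem_comap, ← IsScalarTower.algebraMap_apply] at this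
  have hy0 : y ≠ 0 := by
    rintro rfl
    rw [zero_pow hm.ne', eq_comm, map_eq_zero_iff _ (algebraMap F E).injective] at hy
    rw [hy, zero_sub, Valuation.map_neg,
      ValuationSubring.valuation_algebraMap_lt_one_iff P.const_mem] at hu
    exact hα (pow_eq_zero_iff hm.ne' |>.mp hu)
  obtain ⟨hfin, hgal⟩ :=
    isGalois_of_pow_eq hm (hζ.map_of_injective (algebraMap K F).injective) hy0 hy hgen
  have hres : ∀ V : ValuationSubring E, V.comap (algebraMap F E) = P.ring →
      ∃ a : K, a ≠ 0 ∧ V.valuation (y - algebraMap K E a) < 1 := by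
    intro V hV
    rw [← hV, ValuationSubring.valuation_comap_lt_one_iff, map_sub, ← hy,
      ← IsScalarTower.algebraMap_apply] at hu
    -- Since `y^m - α^m = ∏ (y - ζ^i α)` has valuation less than `1`, so does one of the factors.
    have hprod := congrArg (aeval y) (X_pow_sub_C_eq_prod hζ hm (rfl : α ^ m = α ^ m))
    simp only [map_sub, map_pow, aeval_X, aeval_C, map_prod] at hprod
    rw [map_pow, hprod] at hu
    obtain ⟨i, -, hi⟩ := V.valuation_lt_one_of_prod_lt_one hu
    exact ⟨ζ ^ i * α, mul_ne_zero (pow_ne_zero _ (hζ.ne_zero hm.ne')) hα, by simpa using hi⟩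
  have hσ : ∀ σ : E ≃ₐ[F] E, ∃ c : K, σ y = algebraMap K E c * y := by
    intro σ
    have : NeZero m := ⟨hm.ne'⟩
    have h1 : (σ y / y) ^ m = 1 := by
      rw [div_pow, ← map_pow, hy, σ.commutes, div_self]
      rw [← hy]
      exact pow_ne_zero _ hy0
    obtain ⟨i, -, hi⟩ :=
      (hζ.map_of_injective (algebraMap K E).injective).eq_pow_of_pow_eq_one h1
    exact ⟨ζ ^ i, by rw [map_pow, hi, div_mul_cancel₀ _ hy0]⟩
  choose c hc using hσ
  have hc1 : ∀ σ, σ ≠ 1 → c σ ≠ 1 := by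
    intro σ hσ h
    apply hσ
    have h1 : σ y = y := by rw [hc, h, map_one, one_mul]
    have h2 : (σ : E →ₐ[F] E).comp (⊤ : IntermediateField F E).val =
        (⊤ : IntermediateField F E).val :=
      IntermediateField.algHom_ext_of_eq_adjoin F hgen.symm fun x hx => by
        rw [Set.mem_singleton_iff] at hx
        subst hx
        exact h1
    ext z
    exact DFunLike.congr_fun h2 ⟨z, IntermediateField.mem_top⟩
  refine ⟨⟨hfin, ?_⟩, fun Q hQ => Q.isRational_iff.mpr fun z hz => ?_⟩
  · rw [ncard_liesOver]
    exact ValuationSubring.ncard_comap_eq_finrank hc hc1 P.const_mem hres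
  · obtain ⟨a, ha, hQa⟩ := hres Q.ring hQ
    obtain ⟨e, he⟩ := ValuationSubring.exists_kummer_idempotent hc hc1 ha
    obtain ⟨h1, h2⟩ := he Q.ring Q.const_mem hQa
    obtain ⟨t, ht, hzt⟩ := ValuationSubring.exists_sub_algebraMap_lt_one hQ h1 h2 hz
    obtain ⟨b, hb⟩ := P.isRational_iff.mp hP t ht
    refine ⟨b, ?_⟩
    rw [← hQ, ValuationSubring.valuation_comap_lt_one_iff, map_sub,
      ← IsScalarTower.algebraMap_apply] at hb
    have := Valuation.map_add_lt _ hzt hb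
    rwa [sub_add_sub_cancel] at this

theorem liesOver_trans {L : Type*} [Field L] [Algebra K L] [Algebra F L] [Algebra E L]
    [IsScalarTower F E L] {P : Place K F} {Q : Place K E} {R : Place K L}
    (hR : R.LiesOver Q) : R.LiesOver P ↔ Q.LiesOver P := by
  unfold LiesOver at *
  rw [← hR, ValuationSubring.comap_comap, ← IsScalarTower.algebraMap_eq]

theorem exists_liesOver {L : Type*} [Field L] [Algebra K L] [Algebra F L] [Algebra E L]
    [IsScalarTower F E L] [IsScalarTower K E L] {P : Place K F} {R : Place K L}
    (hR : R.LiesOver P) : ∃ Q : Place K E, R.LiesOver Q := by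
  have hRF : (R.ring.comap (algebraMap E L)).comap (algebraMap F E) = P.ring := by
    rw [ValuationSubring.comap_comap, ← IsScalarTower.algebraMap_eq]
    exact hR
  refine ⟨⟨R.ring.comap (algebraMap E L), fun c => ?_, fun htop => ?_⟩, rfl⟩
  · rw [ValuationSubring.mem_comap, ← IsScalarTower.algebraMap_apply]
    exact R.const_mem c
  · refine P.ne_top (hRF.symm.trans ?_)
    rw [htop]
    ext z
    simp only [ValuationSubring.mem_comap, ValuationSubring.mem_top]

/-- The places of `L` over `P` are partitioned by their restrictions to `E`, and degrees multiply.
-/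
theorem SplitsCompletely.trans {L : Type*} [Field L] [Algebra K L] [Algebra F L] [Algebra E L]
    [IsScalarTower F E L] [IsScalarTower K E L] {P : Place K F} (hP : P.SplitsCompletely E)
    (hQ : ∀ Q : Place K E, Q.LiesOver P → Q.SplitsCompletely L) : P.SplitsCompletely L := by
  classical
  obtain ⟨hfin, hcard⟩ := hP
  have hpos : {Q : Place K E | Q.LiesOver P}.ncard ≠ 0 := by
    rw [hcard]
    exact Module.finrank_pos.ne'
  -- An infinite set has `ncard` zero, so a positive count also yields finiteness.
  have hfinset : {Q : Place K E | Q.LiesOver P}.Finite := Set.finite_of_ncard_ne_zero hpos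
  obtain ⟨Q₀, hQ₀⟩ := Set.nonempty_of_ncard_ne_zero hpos
  have hEL : FiniteDimensional E L := (hQ Q₀ hQ₀).1
  refine ⟨FiniteDimensional.trans F E L, ?_⟩
  have hunion : {R : Place K L | R.LiesOver P} =
      ⋃ Q ∈ {Q : Place K E | Q.LiesOver P}, {R : Place K L | R.LiesOver Q} := by
    ext R
    simp only [Set.mem_ofPred_eq, Set.mem_iUnion, exists_prop]
    constructor
    · intro hR
      obtain ⟨Q, hRQ⟩ := exists_liesOver (E := E) hR
      exact ⟨Q, (liesOver_trans hRQ).mp hR, hRQ⟩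
    · rintro ⟨Q, hQP, hRQ⟩
      exact (liesOver_trans hRQ).mpr hQP
  have hone : ∀ Q ∈ {Q : Place K E | Q.LiesOver P},
      {R : Place K L | R.LiesOver Q}.ncard = Module.finrank E L := fun Q h =>
    (hQ Q h).2
  rw [hunion, hfinset.ncard_biUnion, finsum_mem_congr rfl hone,
    finsum_mem_eq_finite_toFinset_sum _ hfinset, Finset.sum_const, smul_eq_mul,
    ← Set.ncard_eq_toFinset_card _ hfinset, hcard, Module.finrank_mul_finrank]
  · intro Q h
    refine Set.finite_of_ncard_ne_zero ?_
    rw [hone Q h]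
    exact Module.finrank_pos.ne'
  · intro Q _ Q' _ hne
    refine Set.disjoint_left.mpr fun R hR hR' => hne (ring_injective ?_)
    exact Eq.trans (Eq.symm hR) hR'

end KummerTower.Place

/-! ### Norms and roots of unity in finite fields. -/

section FiniteField

variable {k K : Type*} [Field k] [Field K] [Algebra k K] [Finite K]

theorem FiniteField.mem_range_algebraMap_of_pow_card_eq {c : K} (hc : c ^ Nat.card k = c) :
    c ∈ Set.range (algebraMap k K) := by
  have := Finite.of_injective _ (algebraMap k K).injective
  have := Fintype.ofFinite k
  rw [IsGalois.mem_range_algebraMap_iff_fixed]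
  intro σ
  obtain ⟨i, hi⟩ := (FiniteField.bijective_frobeniusAlgEquivOfAlgebraic_pow k K).surjective σ
  rw [← hi]
  change ((FiniteField.frobeniusAlgEquivOfAlgebraic k K) ^ (i : ℕ)) c = c
  rw [AlgEquiv.coe_pow]
  refine Function.iterate_fixed ?_ _
  rw [FiniteField.coe_frobeniusAlgEquivOfAlgebraic, Fintype.card_eq_nat_card]
  exact hc

/-- The exponent is that of the norm `K → k`, which is surjective for finite fields. -/
theorem FiniteField.exists_pow_eq_of_pow_card_eq {c : K} (hc : c ^ Nat.card k = c) :
    ∃ α : K, α ^ ((Nat.card K - 1) / (Nat.card k - 1)) = c := by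
  obtain ⟨b, rfl⟩ := mem_range_algebraMap_of_pow_card_eq hc
  obtain ⟨α, rfl⟩ := FiniteField.norm_surjective k K b
  exact ⟨α, FiniteField.algebraMap_norm_eq_pow.symm⟩

theorem FiniteField.exists_isPrimitiveRoot {m : ℕ} (hm : m ∣ Nat.card K - 1) :
    ∃ ζ : K, IsPrimitiveRoot ζ m := by
  obtain ⟨d, hd⟩ := hm
  obtain ⟨g, hg⟩ := IsCyclic.exists_ofOrder_eq_natCard (α := Kˣ)
  rw [Nat.card_units] at hg
  have hpos : 0 < Nat.card K - 1 := Nat.sub_pos_of_lt Finite.one_lt_card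
  have h1 : IsPrimitiveRoot (g : K) (Nat.card K - 1) :=
    IsPrimitiveRoot.coe_units_iff.mpr (hg ▸ IsPrimitiveRoot.orderOf g)
  exact ⟨_, h1.pow hpos (hd.trans (mul_comm _ _))⟩

end FiniteField

theorem FiniteField.pow_card_eq_of_mem_range {k K : Type*} [Field k] [Field K] [Algebra k K]
    [Finite k] {c : K}
    (hc : c ∈ (algebraMap k K).range) : c ^ Nat.card k = c := by
  have := Fintype.ofFinite k
  obtain ⟨b, rfl⟩ := hc
  rw [← map_pow, ← Fintype.card_eq_nat_card, FiniteField.pow_card]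

/-! ### Values of quasi-symmetric polynomials. -/

namespace KummerTower

/-- Coefficients in `k` give `f(a)^q = f(a^q)`; replacing `a` by `a^q` rotates the arguments
`a^(q^i)`, which the cyclic symmetry absorbs. -/
theorem IsNQQuasiSymmetric.eval_pow_card {k K : Type*} [Field k] [Finite k] [Field K]
    [Algebra k K] [Finite K] {n : ℕ} (hn : Nat.card K = Nat.card k ^ n) {f : K[X]}
    (hf : IsNQQuasiSymmetric n (Nat.card k) f) (hfk : ∀ j, f.coeff j ∈ (algebraMap k K).range)
    (a : K) : (f.eval a) ^ Nat.card k = f.eval a := by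
  have := Fintype.ofFinite k
  have := Fintype.ofFinite K
  have hfrob : (f.eval a) ^ Nat.card k = f.eval (a ^ Nat.card k) := by
    obtain ⟨f₀, rfl⟩ : ∃ f₀ : k[X], f₀.map (algebraMap k K) = f :=
      (Polynomial.mem_map_range _).mpr hfk
    have h := (aeval_algHom_apply (FiniteField.frobeniusAlgHom k K) a f₀).symm
    rw [FiniteField.frobeniusAlgHom_apply, FiniteField.frobeniusAlgHom_apply,
      Fintype.card_eq_nat_card] at h
    simpa only [eval_map_algebraMap] using h
  rw [hfrob]
  obtain ⟨P, hP, rfl⟩ := hf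
  have heval : ∀ b : K, (MvPolynomial.aeval (fun i : Fin n => (X : K[X]) ^ Nat.card k ^ (i : ℕ))
      P).eval b = MvPolynomial.aeval (fun i : Fin n => b ^ Nat.card k ^ (i : ℕ)) P := fun b => by
    rw [← coe_aeval_eq_eval, MvPolynomial.comp_aeval_apply]
    simp
  rw [heval, heval]
  conv_rhs => rw [← hP, MvPolynomial.aeval_rename]
  congr 2
  ext i
  rw [← pow_mul, ← pow_succ', Function.comp_apply]
  obtain ⟨n, rfl⟩ : ∃ n', n = n' + 1 := ⟨n - 1, by have := i.pos; omega⟩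
  rw [coe_finRotate]
  split_ifs with h
  -- The last argument wraps around to the first because `a^(q^n) = a` in `K`.
  · rw [h, Fin.val_last, ← hn, ← Fintype.card_eq_nat_card, FiniteField.pow_card, pow_zero, pow_one]
  · rfl

/-! ### Residues of `g(x)/h(x)` at rational places. -/

namespace Place

variable {K F : Type*} [Field K] [Field F] [Algebra K F]

theorem valuation_aeval_sub_lt_one (P : Place K F) {t : F} {a : K}
    (ht : P.ring.valuation (t - algebraMap K F a) < 1) (g : K[X]) :
    P.ring.valuation (aeval t g - algebraMap K F (g.eval a)) < 1 := by
  have htP : t ∈ P.ring := by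
    have := P.ring.toSubring.add_mem ((P.ring.valuation_le_one_iff _).mp ht.le) (P.const_mem a)
    rwa [sub_add_cancel] at this
  obtain ⟨d, hd⟩ := X_sub_C_dvd_sub_C_eval (a := a) (p := g)
  have h := congrArg (aeval t) hd
  simp only [map_sub, map_mul, aeval_X, aeval_C] at h
  rw [h, map_mul]
  refine mul_lt_one_of_lt_of_le ht ((P.ring.valuation_le_one_iff _).mpr ?_)
  rw [aeval_eq_sum_range]
  refine P.ring.toSubring.sum_mem fun i _ => ?_
  rw [Algebra.smul_def]
  exact P.ring.toSubring.mul_mem (P.const_mem _) (P.ring.toSubring.pow_mem htP _)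

theorem valuation_div_sub_lt_one (P : Place K F) {t : F} {a : K}
    (ht : P.ring.valuation (t - algebraMap K F a) < 1) (g h : K[X]) (hh : h.eval a ≠ 0) :
    P.ring.valuation (aeval t g / aeval t h - algebraMap K F (g.eval a / h.eval a)) < 1 := by
  have h1 := P.valuation_aeval_sub_lt_one ht g
  have h2 := P.valuation_aeval_sub_lt_one ht h
  have hc : P.ring.valuation (algebraMap K F (h.eval a)) = 1 :=
    ValuationSubring.valuation_algebraMap_eq_one P.const_mem hh
  have hv : P.ring.valuation (aeval t h) = 1 :=
    (ValuationSubring.valuation_eq_one_iff_of_sub_lt_one h2).mpr hc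
  have h0 : aeval t h ≠ 0 := by
    rw [← Valuation.ne_zero_iff P.ring.valuation, hv]
    exact one_ne_zero
  have h0' : algebraMap K F (h.eval a) ≠ 0 := by
    rw [← Valuation.ne_zero_iff P.ring.valuation, hc]
    exact one_ne_zero
  have hg : P.ring.valuation (algebraMap K F (g.eval a)) ≤ 1 :=
    (P.ring.valuation_le_one_iff _).mpr (P.const_mem _)
  have heq : aeval t g / aeval t h - algebraMap K F (g.eval a / h.eval a) =
      ((aeval t g - algebraMap K F (g.eval a)) * algebraMap K F (h.eval a) -
        (aeval t h - algebraMap K F (h.eval a)) * algebraMap K F (g.eval a)) /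
        (aeval t h * algebraMap K F (h.eval a)) := by
    rw [map_div₀]
    field_simp
    ring
  rw [heq, map_div₀, map_mul, hv, hc, one_mul, div_one]
  refine Valuation.map_sub_lt _ ?_ ?_
  · rw [map_mul, hc, mul_one]
    exact h1
  · rw [map_mul]
    exact mul_lt_one_of_lt_of_le h2 hg

theorem aeval_inv_reverse_div {x : F} (hx : x ≠ 0) {g h : K[X]}
    (hdeg : g.natDegree = h.natDegree) :
    aeval x⁻¹ g.reverse / aeval x⁻¹ h.reverse = aeval x g / aeval x h := by
  let := invertibleOfNonzero hx
  have hrev : ∀ p : K[X], aeval x⁻¹ p.reverse * x ^ p.natDegree = aeval x p := fun p => by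
    have := eval₂_reverse_mul_pow (algebraMap K F) x p
    rwa [invOf_eq_inv] at this
  rw [← hrev g, ← hrev h, hdeg, mul_div_mul_right _ _ (pow_ne_zero _ hx)]

/-- A quotient of polynomials of equal degree takes, at a rational place, either the value at some
constant, or the quotient of the leading coefficients. -/
theorem exists_valuation_div_sub_lt_one (P : Place K F) (hP : P.IsRational) (x : F) {g h : K[X]}
    (hh : ∀ a : K, h.eval a ≠ 0) (hdeg : g.natDegree = h.natDegree) :
    ∃ c : K, (c = g.leadingCoeff / h.leadingCoeff ∨ ∃ a, c = g.eval a / h.eval a) ∧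
      P.ring.valuation (aeval x g / aeval x h - algebraMap K F c) < 1 := by
  by_cases hx : x ∈ P.ring
  · obtain ⟨a, ha⟩ := P.isRational_iff.mp hP x hx
    exact ⟨_, .inr ⟨a, rfl⟩, P.valuation_div_sub_lt_one ha g h (hh a)⟩
  -- At a pole of `x`, the inverse `x⁻¹` has residue `0`, and the reversed polynomials take their
  -- leading coefficients there.
  · have hx0 : x ≠ 0 := by rintro rfl; exact hx P.ring.zero_mem
    have hinv : P.ring.valuation (x⁻¹ - algebraMap K F 0) < 1 := by
      rw [map_zero, sub_zero, ← ValuationSubring.mem_nonunits_iff,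
        ValuationSubring.inv_mem_nonunits_iff]
      exact .inr hx
    have hlead : ∀ p : K[X], p.reverse.eval 0 = p.leadingCoeff := fun p => by
      rw [← coeff_zero_eq_eval_zero, coeff_zero_reverse]
    have hh0 : h ≠ 0 := by rintro rfl; exact hh 0 eval_zero
    have := P.valuation_div_sub_lt_one hinv g.reverse h.reverse
      (by rw [hlead]; exact leadingCoeff_ne_zero.mpr hh0)
    rw [aeval_inv_reverse_div hx0 hdeg, hlead, hlead] at this
    exact ⟨_, .inl rfl, this⟩

end Place

/-! ### Climbing the tower. -/

theorem adjoin_inclusion_eq_top {F Ω : Type*} [Field F] [Field Ω] [Algebra F Ω]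
    {E L : IntermediateField F Ω} (hle : E ≤ L) (y : L)
    (hL : ∀ z ∈ L, z ∈ IntermediateField.adjoin E {(y : Ω)}) :
    letI := (IntermediateField.inclusion hle).toAlgebra
    IntermediateField.adjoin E {y} = ⊤ := by
  let := (IntermediateField.inclusion hle).toAlgebra
  have : IsScalarTower E L Ω := .of_algebraMap_eq fun _ => rfl
  change IntermediateField.adjoin E {y} = ⊤
  rw [eq_top_iff]
  intro z _
  have hz := hL z z.2
  have himage : IntermediateField.adjoin E {(y : Ω)} =
      (IntermediateField.adjoin E {y}).map (IsScalarTower.toAlgHom E L Ω) := by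
    rw [IntermediateField.adjoin_map, Set.image_singleton]
    rfl
  rw [himage] at hz
  obtain ⟨w, hw, hwz⟩ := hz
  rwa [← show w = z from Subtype.ext hwz]

theorem coe_aeval_div {K Ω : Type*} [Field K] [Field Ω] [Algebra K Ω] {F : IntermediateField K Ω}
    {E : IntermediateField F Ω} (t : E) (g h : K[X]) :
    ((aeval t g / aeval t h : E) : Ω) = aeval (t : Ω) g / aeval (t : Ω) h := by
  have : IsScalarTower K E Ω := .of_algebraMap_eq fun _ => rfl
  have hval : ∀ p : K[X], aeval (t : Ω) p = ((aeval t p : E) : Ω) :=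
    fun p => aeval_algebraMap_apply Ω t p
  rw [hval, hval]
  rfl

/-- `P` splits completely in `E`, with only rational places above it. -/
def Place.SplitsRationally {K F : Type*} [Field K] [Field F] [Algebra K F] (P : Place K F)
    (E : Type*) [Field E] [Algebra K E] [Algebra F E] : Prop :=
  P.SplitsCompletely E ∧ ∀ Q : Place K E, Q.LiesOver P → Q.IsRational

/-- Rationality of the intermediate places is part of the induction because it is what makes the
residue of `g(t)/h(t)` a constant, and so an `m`-th power. -/
theorem Place.SplitsRationally.kummer {K F E L : Type*} [Field K] [Field F] [Field E] [Field L]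
    [Algebra K F] [Algebra K E] [Algebra K L] [Algebra F E] [Algebra F L] [Algebra E L]
    [IsScalarTower F E L] [IsScalarTower K E L]
    {m : ℕ} (hm : 0 < m) {ζ : K} (hζ : IsPrimitiveRoot ζ m)
    {g h : K[X]} (hh : ∀ a : K, h.eval a ≠ 0) (hdeg : g.natDegree = h.natDegree)
    (hpow : ∀ c : K, (c = g.leadingCoeff / h.leadingCoeff ∨ ∃ a, c = g.eval a / h.eval a) →
      ∃ α : K, α ≠ 0 ∧ α ^ m = c) {t : E} {y : L}
    (hy : y ^ m = algebraMap E L (aeval t g / aeval t h))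
    (hgen : IntermediateField.adjoin E {y} = ⊤) {P : Place K F}
    (hP : P.SplitsRationally E) : P.SplitsRationally L := by
  have step : ∀ Q : Place K E, Q.LiesOver P → Q.SplitsRationally L := by
    intro Q hQ
    obtain ⟨c, hc, hQc⟩ := Q.exists_valuation_div_sub_lt_one (hP.2 Q hQ) t hh hdeg
    obtain ⟨α, hα, rfl⟩ := hpow c hc
    exact Place.splitsCompletely_of_pow_eq hm hζ hy hgen Q (hP.2 Q hQ) hα hQc
  refine ⟨hP.1.trans fun Q hQ => (step Q hQ).1, fun R hR => ?_⟩
  obtain ⟨Q, hRQ⟩ := Place.exists_liesOver (E := E) hR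
  exact (step Q ((Place.liesOver_trans hRQ).mp hR)).2 R hRQ

section Tower

variable {K Ω : Type*} [Field K] [Field Ω] [Algebra K Ω] (x : ℕ → Ω)

theorem mem_field {i j : ℕ} (h : i ≤ j) : x i ∈ field K x j :=
  IntermediateField.subset_adjoin K _ ⟨i, h, rfl⟩

theorem mem_adjoin_of_mem_field_succ {F : Type*} [Field F] [Algebra F Ω]
    {E : IntermediateField F Ω} {j : ℕ} (hE : ∀ z ∈ field K x j, z ∈ E) {z : Ω}
    (hz : z ∈ field K x (j + 1)) : z ∈ IntermediateField.adjoin E {x (j + 1)} := by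
  have hE' : ∀ z ∈ field K x j, z ∈ IntermediateField.adjoin E {x (j + 1)} := fun z hz =>
    (IntermediateField.adjoin E {x (j + 1)}).algebraMap_mem ⟨z, hE z hz⟩
  refine IntermediateField.adjoin_induction K (p := fun z _ => z ∈ IntermediateField.adjoin E
    {x (j + 1)}) ?_ (fun c => hE' _ ((field K x j).algebraMap_mem c))
    (fun _ _ _ _ => add_mem) (fun _ _ => inv_mem) (fun _ _ _ _ => mul_mem) hz
  rintro _ ⟨l, hl, rfl⟩
  rcases Nat.le_succ_iff.mp hl with hl | rfl
  · exact hE' _ (mem_field x hl)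
  · exact IntermediateField.subset_adjoin _ _ rfl

/-- `E` and `L` have base `F`, while the fields of the tower have base `K`; hence they are matched
by membership. -/
theorem splitsRationally_succ {m : ℕ} (hm : 0 < m) {ζ : K} (hζ : IsPrimitiveRoot ζ m)
    {g h : K[X]} (hh : ∀ a : K, h.eval a ≠ 0) (hdeg : g.natDegree = h.natDegree)
    (hpow : ∀ c : K, (c = g.leadingCoeff / h.leadingCoeff ∨ ∃ a, c = g.eval a / h.eval a) →
      ∃ α : K, α ≠ 0 ∧ α ^ m = c) {F : IntermediateField K Ω} {j : ℕ}
    (hrec : x (j + 1) ^ m = aeval (x j) g / aeval (x j) h) {E L : IntermediateField F Ω}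
    (hle : E ≤ L) (hE : ∀ z, z ∈ E ↔ z ∈ field K x j) (hL : ∀ z, z ∈ L ↔ z ∈ field K x (j + 1))
    {P : Place K F} (hP : P.SplitsRationally E) : P.SplitsRationally L := by
  let := (IntermediateField.inclusion hle).toAlgebra
  have : IsScalarTower F E L := .of_algebraMap_eq fun _ => rfl
  have : IsScalarTower K E L := .of_algebraMap_eq fun _ => rfl
  have hgen := adjoin_inclusion_eq_top hle ⟨x (j + 1), (hL _).mpr (mem_field x le_rfl)⟩
    fun z hz => mem_adjoin_of_mem_field_succ x (fun z => (hE z).mpr) ((hL z).mp hz)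
  refine hP.kummer hm hζ hh hdeg hpow (t := ⟨x j, (hE _).mpr (mem_field x le_rfl)⟩)
    (Subtype.ext ?_) hgen
  change x (j + 1) ^ m = _
  rw [hrec]
  exact (coe_aeval_div (⟨x j, (hE _).mpr (mem_field x le_rfl)⟩ : E) g h).symm

/-- In the Kummer tower `x (i + 1) ^ m = g (x i) / h (x i)` rational places split completely, if
all constants that `g / h` takes as values, at infinity too, are nonzero `m`-th powers. -/
theorem splitsCompletely_field {m : ℕ} (hm : 0 < m) {ζ : K} (hζ : IsPrimitiveRoot ζ m)
    {g h : K[X]} (hh : ∀ a : K, h.eval a ≠ 0) (hdeg : g.natDegree = h.natDegree)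
    (hpow : ∀ c : K, (c = g.leadingCoeff / h.leadingCoeff ∨ ∃ a, c = g.eval a / h.eval a) →
      ∃ α : K, α ≠ 0 ∧ α ^ m = c)
    (hrec : ∀ i, x (i + 1) ^ m = aeval (x i) g / aeval (x i) h)
    (i j : ℕ) (hij : i ≤ j) (P : Place K (field K x i)) (hP : P.IsRational) :
    P.SplitsRationally (IntermediateField.extendScalars (field_mono K x hij)) := by
  induction j, hij using Nat.le_induction with
  | base =>
    -- The trivial extension is treated as the Kummer extension generated by `y = 1` with exponent
    -- `1`.
    refine Place.splitsCompletely_of_pow_eq (m := 1) one_pos (ζ := 1) .one (y := 1) (u := 1)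
      (by simp) ?_ P hP (α := 1) one_ne_zero (by simp)
    rw [eq_top_iff]
    intro z _
    exact IntermediateField.algebraMap_mem _ (⟨z.1, z.2⟩ : field K x i)
  | succ j hij ih =>
    exact splitsRationally_succ x hm hζ hh hdeg hpow (hrec j)
      (IntermediateField.extendScalars_le_extendScalars_iff _ _ |>.mpr (field_mono K x j.le_succ))
      (fun _ => IntermediateField.mem_extendScalars _)
      (fun _ => IntermediateField.mem_extendScalars _) ih

end Tower

end KummerTower

/-- The fields of the tower are indexed from `0`: `field K x i` is `K(x₀, …, xᵢ)`. -/
theorem mainTheorem5 {k K Ω : Type*} [Field k] [Finite k] [Field K] [Algebra k K]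
    [Field Ω] [Algebra K Ω] (q n : ℕ) (hq : Nat.card k = q) (hn : Module.finrank k K = n)
    (hn1 : 1 < n) (g h : K[X])
    (hg : KummerTower.IsNQQuasiSymmetric n q g) (hh : KummerTower.IsNQQuasiSymmetric n q h)
    (hgk : ∀ j, g.coeff j ∈ (algebraMap k K).range)
    (hhk : ∀ j, h.coeff j ∈ (algebraMap k K).range)
    (hg0 : ∀ a : K, g.eval a ≠ 0) (hh0 : ∀ a : K, h.eval a ≠ 0)
    (hdeg : g.natDegree = h.natDegree)
    (x : ℕ → Ω) (hx : Transcendental K (x 0))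
    (hrec : ∀ i, x (i + 1) ^ ((q ^ n - 1) / (q - 1)) = aeval (x i) g / aeval (x i) h)
    (hpow : ∀ i, ∀ w ∈ KummerTower.field K x i,
      aeval (x i) g / aeval (x i) h ≠ w ^ ((q ^ n - 1) / (q - 1))) :
    ∀ (i j : ℕ) (hij : i ≤ j) (P : KummerTower.Place K (KummerTower.field K x i)),
      P.IsRational →
        P.SplitsCompletely
          (IntermediateField.extendScalars (KummerTower.field_mono K x hij)) := by
  subst hq hn
  have : FiniteDimensional k K := Module.finite_of_finrank_pos (zero_lt_one.trans hn1)
  have : Finite K := Module.finite_of_finite k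
  have hcard : Nat.card K = Nat.card k ^ Module.finrank k K := Module.natCard_eq_pow_finrank
  have hk : 1 < Nat.card k := Finite.one_lt_card
  have hdvd : Nat.card k - 1 ∣ Nat.card K - 1 := by
    simpa [hcard] using Nat.sub_dvd_pow_sub_pow (Nat.card k) 1 (Module.finrank k K)
  rw [← hcard] at hrec
  have hm : 0 < (Nat.card K - 1) / (Nat.card k - 1) :=
    Nat.div_pos (Nat.le_of_dvd (Nat.sub_pos_of_lt Finite.one_lt_card) hdvd) (Nat.sub_pos_of_lt hk)
  obtain ⟨ζ, hζ⟩ := FiniteField.exists_isPrimitiveRoot (K := K) (Nat.div_dvd_of_dvd hdvd)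
  have hlead : ∀ {f : K[X]}, (∀ a : K, f.eval a ≠ 0) → f.leadingCoeff ≠ 0 := fun hf =>
    leadingCoeff_ne_zero.mpr (by rintro rfl; exact hf 0 eval_zero)
  have hpow' : ∀ c : K, (c = g.leadingCoeff / h.leadingCoeff ∨ ∃ a, c = g.eval a / h.eval a) →
      ∃ α : K, α ≠ 0 ∧ α ^ ((Nat.card K - 1) / (Nat.card k - 1)) = c := by
    intro c hc
    -- Both kinds of residue are nonzero and fixed by the `q`-power map, so they lie in `k` and are
    -- norms, that is, `m`-th powers.
    have hc' : c ≠ 0 ∧ c ^ Nat.card k = c := by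
      rcases hc with rfl | ⟨a, rfl⟩
      · exact ⟨div_ne_zero (hlead hg0) (hlead hh0), by
          rw [div_pow, leadingCoeff, leadingCoeff,
            FiniteField.pow_card_eq_of_mem_range (hgk _),
            FiniteField.pow_card_eq_of_mem_range (hhk _)]⟩
      · exact ⟨div_ne_zero (hg0 a) (hh0 a), by
          rw [div_pow, hg.eval_pow_card hcard hgk, hh.eval_pow_card hcard hhk]⟩
    obtain ⟨α, hα⟩ := FiniteField.exists_pow_eq_of_pow_card_eq hc'.2
    refine ⟨α, ?_, hα⟩
    rintro rfl
    rw [zero_pow hm.ne'] at hα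
    exact hc'.1 hα.symm
  exact fun i j hij P hP =>
    (KummerTower.splitsCompletely_field x hm hζ hh0 hdeg hpow' hrec i j hij P hP).1
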